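/- Let $a_n>0$ and $b_n\in\mathbb R$, $n\in\mathbb Z_+=\{0,1,\dots\}$, and let $\mathcal J$ act on sequences by $(\mathcal Ju)_0=b_0u_0+a_0u_1$ and $(\mathcal Ju)_n=a_{n-1}u_{n-1}+b_nu_n+a_nu_{n+1}$ for $n\ge 1$. In the complex Hilbert space $\ell^2(\mathbb Z_+)$ let $J_{\min}$ be the restriction of $\mathcal J$ to the sequences with finitely many non-zero components, and $J_{\max}$ the restriction of $\mathcal J$ to $\{u\in\ell^2(\mathbb Z_+):\mathcal Ju\in\ell^2(\mathbb Z_+)\}$. Suppose that $\operatorname{clos}J_{\min}\ne J_{\max}$ (equivalently, $J_{\min}$ is not essentially self-adjoint). Let $p(z)=(p_n(z))$ and $q(z)=(q_n(z))$ be the solutions of $a_{n-1}u_{n-1}+b_nu_n+a_nu_{n+1}=zu_n$, $n\ge1$, with $p_0(z)=1$, $p_1(z)=(z-b_0)/a_0$, $q_0(z)=0$, $q_1(z)=1/a_0$. For $t\in\mathbb R\cup\{\infty\}$ let $J_t$ be the restriction of $J_{\max}$ to $$\mathcal D(J_t)=\mathcal D(\operatorname{clos}J_{\min})+\mathbb C\,(t\,p(0)+q(0))\quad(t\in\mathbb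 R),\qquad \mathcal D(J_\infty)=\mathcal D(\operatorname{clos}J_{\min})+\mathbb C\,p(0).$$ Let $J$ be one of the operators $J_t$, $t\in\mathbb R\cup\{\infty\}$, or an arbitrary self-adjoint extension of $J_{\min}$. If $z\in\mathbb C$ is not an eigenvalue of $J$, then the resolvent $R(z)=(J-zI)^{-1}$ exists as a bounded operator defined on the whole of $\ell^2(\mathbb Z_+)$, and it is a Hilbert–Schmidt operator. Moreover, the spectrum of $J$ is discrete, that is, it has no accumulation points in $\mathbb C$ and consists of eigenvalues of finite multiplicity. -/

import Mathlib

open scoped Topology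

noncomputable section

/-! ### Unbounded operators: eigenvalues, resolvent, spectrum, Hilbert-Schmidt class -/

namespace UnboundedOp

universe u

variable {E : Type u} [NormedAddCommGroup E] [InnerProductSpace ℂ E]

/-- The eigenspace `ker (T - z)`, as a subspace of the domain of `T`. -/
def eigenspace (T : E →ₗ.[ℂ] E) (z : ℂ) : Submodule ℂ T.domain :=
  LinearMap.ker (T.toFun - z • T.domain.subtype)

/-- `z` is an eigenvalue of `T`. -/
def IsEigenvalue (T : E →ₗ.[ℂ] E) (z : ℂ) : Prop :=
  ∃ u : T.domain, u ≠ 0 ∧ T u = z • (u : E)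

/-- The bounded, everywhere defined operator `R` is the resolvent `(T - z)⁻¹`: the graph of `R` is
the inverse of the graph of `T - z`. Such an `R` is unique if it exists. -/
def IsResolventAt (T : E →ₗ.[ℂ] E) (z : ℂ) (R : E →L[ℂ] E) : Prop :=
  ∀ u h : E, R h = u ↔ ∃ hu : u ∈ T.domain, T ⟨u, hu⟩ - z • u = h

/-- The spectrum: the points at which `T` has no bounded, everywhere defined resolvent. -/
def spectrum (T : E →ₗ.[ℂ] E) : Set ℂ :=
  {z | ¬ ∃ R : E →L[ℂ] E, IsResolventAt T z R}

/-- The spectrum is discrete: it has no accumulation point in `ℂ` and it consists of eigenvalues of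
finite multiplicity. -/
def HasDiscreteSpectrum (T : E →ₗ.[ℂ] E) : Prop :=
  (∀ z : ℂ, ¬ AccPt z (Filter.principal (spectrum T))) ∧
    ∀ z ∈ spectrum T, IsEigenvalue T z ∧ FiniteDimensional ℂ (eigenspace T z)

/-- `A` belongs to the Hilbert-Schmidt class: `∑ ‖A eᵢ‖² < ∞` for an orthonormal (Hilbert) basis
`(eᵢ)`; the sum does not depend on the basis. -/
def IsHilbertSchmidt (A : E →L[ℂ] E) : Prop :=
  ∃ (ι : Type u) (e : HilbertBasis ι ℂ E), Summable fun i => ‖A (e i)‖ ^ 2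

end UnboundedOp

/-! ### Jacobi operators in `ℓ²(ℤ₊)` -/

namespace Jacobi

/-- The complex Hilbert space `ℓ²(ℤ₊)`. -/
abbrev L2 : Type := lp (fun _ : ℕ => ℂ) 2

/-- The action of the Jacobi matrix with off-diagonal entries `a` and diagonal entries `b` on
arbitrary sequences. -/
def matrixAct (a b : ℕ → ℝ) : (ℕ → ℂ) →ₗ[ℂ] (ℕ → ℂ) where
  toFun u n := match n with
    | 0 => b 0 * u 0 + a 0 * u 1
    | n + 1 => a n * u n + b (n + 1) * u (n + 1) + a (n + 1) * u (n + 2)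
  map_add' u v := by
    funext n
    cases n <;> simp <;> ring
  map_smul' c u := by
    funext n
    cases n <;> simp <;> ring

/-- The maximal operator: the action of the matrix on all `u ∈ ℓ²` with `𝒥 u ∈ ℓ²`. -/
def Jmax (a b : ℕ → ℝ) : L2 →ₗ.[ℂ] L2 where
  domain :=
    { carrier := {u | Memℓp (matrixAct a b u) 2}
      zero_mem' := by
        change Memℓp (matrixAct a b (0 : ℕ → ℂ)) 2
        rw [map_zero]
        exact zero_memℓp
      add_mem' := fun {u v} hu hv => by
        change Memℓp (matrixAct a b ((u : ℕ → ℂ) + (v : ℕ → ℂ))) 2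
        rw [map_add]
        exact Memℓp.add hu hv
      smul_mem' := fun c u hu => by
        change Memℓp (matrixAct a b (c • (u : ℕ → ℂ))) 2
        rw [map_smul]
        exact Memℓp.const_smul hu c }
  toFun :=
    { toFun := fun u => ⟨matrixAct a b (u : L2), u.2⟩
      map_add' := fun u v => by
        refine lp.ext ?_
        exact map_add (matrixAct a b) ((u : L2) : ℕ → ℂ) ((v : L2) : ℕ → ℂ)
      map_smul' := fun c u => by
        refine lp.ext ?_
        exact map_smul (matrixAct a b) c ((u : L2) : ℕ → ℂ) }

/-- The subspace of sequences with finitely many non-zero components. -/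
def finSupp : Submodule ℂ L2 where
  carrier := {u | (Function.support (u : ℕ → ℂ)).Finite}
  zero_mem' := by
    change (Function.support (0 : ℕ → ℂ)).Finite
    simp
  add_mem' := fun {u v} hu hv =>
    (hu.union hv).subset (Function.support_add (u : ℕ → ℂ) (v : ℕ → ℂ))
  smul_mem' := fun c u hu => by
    refine hu.subset ?_
    intro n hn h0
    exact hn (by simp [h0])

theorem finSupp_le_domain_Jmax (a b : ℕ → ℝ) : finSupp ≤ (Jmax a b).domain := by
  intro u hu
  have hu' : (Function.support (u : ℕ → ℂ)).Finite := hu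
  obtain ⟨N, hN⟩ := hu'.bddAbove
  have hz : ∀ n, N < n → (u : ℕ → ℂ) n = 0 := fun n hn => by
    by_contra h
    exact absurd (hN h) (not_le.mpr hn)
  have h2 : (Function.support (matrixAct a b (u : ℕ → ℂ))).Finite := by
    refine (Set.finite_Iic (N + 1)).subset ?_
    intro n hn
    by_contra h
    simp only [Set.mem_Iic, not_le] at h
    obtain ⟨m, rfl⟩ : ∃ m, n = m + 1 := ⟨n - 1, by omega⟩
    exact hn (by
      simp [matrixAct, hz m (by omega), hz (m + 1) (by omega), hz (m + 2) (by omega)])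
  exact (memℓp_zero h2).of_exponent_ge (by simp)

/-- The minimal operator: the action of the matrix on finitely supported sequences. -/
def Jmin (a b : ℕ → ℝ) : L2 →ₗ.[ℂ] L2 where
  domain := finSupp
  toFun := (Jmax a b).toFun.comp (Submodule.inclusion (finSupp_le_domain_Jmax a b))

/-- The first kind polynomials `pₙ(z)`. -/
def p (a b : ℕ → ℝ) (z : ℂ) : ℕ → ℂ
  | 0 => 1
  | 1 => (z - b 0) / a 0
  | n + 2 => ((z - b (n + 1)) * p a b z (n + 1) - a n * p a b z n) / a (n + 1)

/-- The second kind polynomials `qₙ(z)`. -/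
def q (a b : ℕ → ℝ) (z : ℂ) : ℕ → ℂ
  | 0 => 0
  | 1 => 1 / a 0
  | n + 2 => ((z - b (n + 1)) * q a b z (n + 1) - a n * q a b z n) / a (n + 1)

/-- The sequence `t p(0) + q(0)` for `t ∈ ℝ`, and `p(0)` for `t = ∞`. -/
def boundarySeq (a b : ℕ → ℝ) (t : OnePoint ℝ) : ℕ → ℂ :=
  t.elim (p a b 0) (fun (s : ℝ) n => s * p a b 0 n + q a b 0 n)

/-- The extension `J_t`, `t ∈ ℝ ∪ {∞}`: the restriction of the maximal operator to the sum of the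
domain of the closure of the minimal operator and the line spanned by `t p(0) + q(0)`
(`p(0)` for `t = ∞`). The set inside the span is this one vector, when it is in `ℓ²`. -/
def Jt (a b : ℕ → ℝ) (t : OnePoint ℝ) : L2 →ₗ.[ℂ] L2 :=
  (Jmax a b).domRestrict
    ((Jmin a b).closure.domain ⊔ Submodule.span ℂ {g : L2 | (g : ℕ → ℂ) = boundarySeq a b t})

end Jacobi

end

namespace Jacobi

open Filter

variable {a b : ℕ → ℝ}

/-! ### Square summable sequences -/

/-! Write `[u, v]` for the bilinear form `∑ (u · 𝒥v - 𝒥u · v)` on the maximal domain. By summation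
by parts it is the limit of the Wronskians of `u` and `v`. Wronskians are 2×2 determinants, so the
Plücker relation survives in the limit (`boundaryForm_plucker`) and the form has rank at most two.
Its radical is the domain of `clos Jmin`, so the hypothesis says precisely that the form is nonzero.

This has two consequences. A Gronwall argument puts every solution of the eigenvalue equation, for
every `z`, in `ℓ²` (`memℓp_of_eigen`); in particular `p(z)` and `q(z)`. Moreover each operator in
question is symmetric and is the restriction of `Jmax` to the kernel of one nonzero functional `[g,
·]` (`IsBoundaryRestriction`).

For such a `J`, variation of constants solves `(𝒥 - z)u = h` by a Volterra operator `V` with square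
summable kernel. Then `R h = V h - ([g, V h] / [g, p(z)]) p(z)` satisfies the boundary condition.
The denominator vanishes only if `p(z)` is an eigenvector. The correction has rank one, so `R` is
Hilbert–Schmidt.

Hence the spectrum consists of eigenvalues, whose eigenspaces lie in the span of `p(z)`. By symmetry
`i` is not an eigenvalue, and eigenvectors of distinct eigenvalues are orthogonal; the
Hilbert–Schmidt bound on the resolvent at `i` leaves only finitely many eigenvalues in each disc. -/

theorem memℓp_two_iff {u : ℕ → ℂ} : Memℓp u 2 ↔ Summable fun n => ‖u n‖ ^ 2 := by
  simpa using memℓp_gen_iff (p := 2) (f := u) (by norm_num)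

theorem summable_norm_mul_norm {u v : ℕ → ℂ} (hu : Memℓp u 2) (hv : Memℓp v 2) :
    Summable fun n => ‖u n‖ * ‖v n‖ := by
  refine Summable.of_nonneg_of_le (fun n => by positivity) (fun n => ?_)
    ((memℓp_two_iff.1 hu).add (memℓp_two_iff.1 hv))
  nlinarith [sq_nonneg (‖u n‖ - ‖v n‖), sq_nonneg (‖u n‖), sq_nonneg (‖v n‖)]

theorem summable_mul {u v : ℕ → ℂ} (hu : Memℓp u 2) (hv : Memℓp v 2) :
    Summable fun n => u n * v n :=
  Summable.of_norm (by simpa using summable_norm_mul_norm hu hv)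

/-! ### The Wronskian and the boundary form -/

/-- The Wronskian `aₙ (uₙ vₙ₊₁ - uₙ₊₁ vₙ)`. -/
def wronskian (a : ℕ → ℝ) (n : ℕ) (u v : ℕ → ℂ) : ℂ :=
  a n * (u n * v (n + 1) - u (n + 1) * v n)

/-- The summand of the boundary form. -/
def greenTerm (a b : ℕ → ℝ) (u v : ℕ → ℂ) (k : ℕ) : ℂ :=
  u k * matrixAct a b v k - matrixAct a b u k * v k

/-- The bilinear boundary form `∑ (u · 𝒥v - 𝒥u · v)`. -/
noncomputable def boundaryForm (a b : ℕ → ℝ) (u v : ℕ → ℂ) : ℂ :=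
  ∑' k, greenTerm a b u v k

/-- The sequences in the domain of the maximal operator. -/
def IsMaximal (a b : ℕ → ℝ) (u : ℕ → ℂ) : Prop :=
  Memℓp u 2 ∧ Memℓp (matrixAct a b u) 2

theorem matrixAct_zero (u : ℕ → ℂ) : matrixAct a b u 0 = b 0 * u 0 + a 0 * u 1 := rfl

theorem matrixAct_succ (u : ℕ → ℂ) (n : ℕ) : matrixAct a b u (n + 1) =
    a n * u n + b (n + 1) * u (n + 1) + a (n + 1) * u (n + 2) := rfl

theorem wronskian_succ (u v : ℕ → ℂ) (n : ℕ) :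
    wronskian a (n + 1) u v = wronskian a n u v + greenTerm a b u v (n + 1) := by
  simp only [wronskian, greenTerm, matrixAct_succ]
  ring

theorem sum_greenTerm (u v : ℕ → ℂ) (n : ℕ) :
    ∑ k ∈ Finset.range (n + 1), greenTerm a b u v k = wronskian a n u v := by
  induction n with
  | zero =>
    simp only [zero_add, Finset.sum_range_one, wronskian, greenTerm, matrixAct_zero]
    ring
  | succ n ih => rw [Finset.sum_range_succ, ih, wronskian_succ (b := b)]

theorem IsMaximal.hasSum {u v : ℕ → ℂ} (hu : IsMaximal a b u) (hv : IsMaximal a b v) :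
    HasSum (greenTerm a b u v) (boundaryForm a b u v) :=
  ((summable_mul hu.1 hv.2).sub (summable_mul hu.2 hv.1)).hasSum

theorem IsMaximal.tendsto_wronskian {u v : ℕ → ℂ} (hu : IsMaximal a b u) (hv : IsMaximal a b v) :
    Tendsto (fun n => wronskian a n u v) atTop (𝓝 (boundaryForm a b u v)) := by
  have h := ((hu.hasSum hv).tendsto_sum_nat).comp (tendsto_add_atTop_nat 1)
  exact h.congr fun n => sum_greenTerm u v n

theorem IsMaximal.add {u v : ℕ → ℂ} (hu : IsMaximal a b u) (hv : IsMaximal a b v) :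
    IsMaximal a b (u + v) :=
  ⟨hu.1.add hv.1, by rw [map_add]; exact hu.2.add hv.2⟩

theorem IsMaximal.smul {u : ℕ → ℂ} (hu : IsMaximal a b u) (c : ℂ) : IsMaximal a b (c • u) :=
  ⟨hu.1.const_smul c, by rw [map_smul]; exact hu.2.const_smul c⟩

theorem IsMaximal.sub {u v : ℕ → ℂ} (hu : IsMaximal a b u) (hv : IsMaximal a b v) :
    IsMaximal a b (u - v) :=
  ⟨hu.1.sub hv.1, by rw [map_sub]; exact hu.2.sub hv.2⟩

theorem matrixAct_star (u : ℕ → ℂ) : matrixAct a b (star u) = star (matrixAct a b u) := by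
  funext n
  cases n <;> simp [matrixAct_zero, matrixAct_succ]

theorem IsMaximal.star {u : ℕ → ℂ} (hu : IsMaximal a b u) : IsMaximal a b (star u) :=
  ⟨hu.1.star_mem, by rw [matrixAct_star]; exact hu.2.star_mem⟩

theorem boundaryForm_star (u v : ℕ → ℂ) :
    boundaryForm a b (star u) (star v) = star (boundaryForm a b u v) := by
  rw [boundaryForm, boundaryForm, tsum_star]
  refine tsum_congr fun k => ?_
  simp [greenTerm, matrixAct_star]

theorem boundaryForm_swap (u v : ℕ → ℂ) : boundaryForm a b v u = -boundaryForm a b u v := by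
  rw [boundaryForm, boundaryForm, ← tsum_neg]
  refine tsum_congr fun k => ?_
  simp only [greenTerm]
  ring

theorem boundaryForm_self (u : ℕ → ℂ) : boundaryForm a b u u = 0 := by
  simp [boundaryForm, greenTerm, mul_comm]

theorem boundaryForm_add_right {u v w : ℕ → ℂ} (hu : IsMaximal a b u) (hv : IsMaximal a b v)
    (hw : IsMaximal a b w) :
    boundaryForm a b u (v + w) = boundaryForm a b u v + boundaryForm a b u w := by
  rw [← ((hu.hasSum hv).add (hu.hasSum hw)).tsum_eq, boundaryForm]
  refine tsum_congr fun k => ?_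
  simp only [greenTerm, map_add, Pi.add_apply]
  ring

theorem boundaryForm_smul_right (u v : ℕ → ℂ) (c : ℂ) :
    boundaryForm a b u (c • v) = c * boundaryForm a b u v := by
  rw [boundaryForm, boundaryForm, ← tsum_mul_left]
  refine tsum_congr fun k => ?_
  simp only [greenTerm, map_smul, Pi.smul_apply, smul_eq_mul]
  ring

theorem boundaryForm_sub_right {u v w : ℕ → ℂ} (hu : IsMaximal a b u) (hv : IsMaximal a b v)
    (hw : IsMaximal a b w) :
    boundaryForm a b u (v - w) = boundaryForm a b u v - boundaryForm a b u w := by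
  have h := boundaryForm_add_right hu hv (hw.smul (-1))
  rw [boundaryForm_smul_right] at h
  rw [show v - w = v + (-1 : ℂ) • w by simp [sub_eq_add_neg], h]
  ring

/-- The identity holds for the Wronskians at each fixed `n`, being the Plücker relation for four
vectors in the plane, and passes to the limit. -/
theorem boundaryForm_plucker {g w x y : ℕ → ℂ} (hg : IsMaximal a b g) (hw : IsMaximal a b w)
    (hx : IsMaximal a b x) (hy : IsMaximal a b y) :
    boundaryForm a b g w * boundaryForm a b x y =
      boundaryForm a b g x * boundaryForm a b w y - boundaryForm a b g y * boundaryForm a b w x := by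
  refine tendsto_nhds_unique
    ((hg.tendsto_wronskian hw).mul (hx.tendsto_wronskian hy)) ?_
  refine (((hg.tendsto_wronskian hx).mul (hw.tendsto_wronskian hy)).sub
    ((hg.tendsto_wronskian hy).mul (hw.tendsto_wronskian hx))).congr fun n => ?_
  simp only [wronskian]
  ring

/-- The kernel of a nonzero functional `boundaryForm a b g` is isotropic. -/
theorem boundaryForm_eq_zero {g w x y : ℕ → ℂ} (hg : IsMaximal a b g) (hw : IsMaximal a b w)
    (hgw : boundaryForm a b g w ≠ 0) (hx : IsMaximal a b x) (hy : IsMaximal a b y)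
    (hgx : boundaryForm a b g x = 0) (hgy : boundaryForm a b g y = 0) :
    boundaryForm a b x y = 0 := by
  have h := boundaryForm_plucker hg hw hx hy
  rw [hgx, hgy] at h
  simpa [hgw] using h

/-! ### Square summability of solutions of the eigenvalue equation -/

theorem IsMaximal.of_eigen {u : ℕ → ℂ} {z : ℂ} (hu : Memℓp u 2)
    (h : ∀ n, matrixAct a b u (n + 1) = z * u (n + 1)) : IsMaximal a b u := by
  refine ⟨hu, ?_⟩
  have h1 := (memℓp_two_iff.1 (hu.const_smul z))
  -- Row zero is discarded, so that `q`, which violates the equation there, is covered.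
  rw [memℓp_two_iff, ← summable_nat_add_iff 1] at *
  simpa only [h, Pi.smul_apply, smul_eq_mul] using h1

/-- A discrete Gronwall inequality with summable coefficients. -/
theorem bounded_of_le_mul_one_add {S ε : ℕ → ℝ} (hS : ∀ n, 0 ≤ S n) (hε : ∀ n, 0 ≤ ε n)
    (hsum : Summable ε) (h : ∀ n, S (n + 1) ≤ S n * (1 + ε n)) : ∃ C, ∀ n, S n ≤ C := by
  have h1 : ∀ n, S n ≤ S 0 * Real.exp (∑ i ∈ Finset.range n, ε i) := fun n => by
    induction n with
    | zero => simp
    | succ n ih =>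
      rw [Finset.sum_range_succ, Real.exp_add, ← mul_assoc]
      have h2 : 1 + ε n ≤ Real.exp (ε n) := by linarith [Real.add_one_le_exp (ε n)]
      exact (h n).trans (mul_le_mul ih h2 (by linarith [hε n])
        (mul_nonneg (hS 0) (Real.exp_pos _).le))
  refine ⟨S 0 * Real.exp (∑' i, ε i), fun n => (h1 n).trans ?_⟩
  exact mul_le_mul_of_nonneg_left (Real.exp_le_exp.2 (hsum.sum_le_tsum _ fun i _ => hε i)) (hS 0)

/-- In the limit circle case all solutions of the eigenvalue equation are square summable. -/
theorem memℓp_of_eigen {u v w : ℕ → ℂ} {z : ℂ} (hu : IsMaximal a b u) (hv : IsMaximal a b v)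
    (huv : boundaryForm a b u v ≠ 0) (hw : ∀ n, matrixAct a b w (n + 1) = z * w (n + 1)) :
    Memℓp w 2 := by
  set c : ℝ := ‖boundaryForm a b u v‖ / 2 with hc
  have hcpos : 0 < c := by positivity
  obtain ⟨N, hN⟩ : ∃ N, ∀ n ≥ N, c ≤ ‖wronskian a n u v‖ := by
    have h := (hu.tendsto_wronskian hv).norm.eventually_const_le
      (u := c) (by rw [hc]; linarith [norm_pos_iff.2 huv])
    exact eventually_atTop.1 h
  set S : ℕ → ℝ := fun n => ‖wronskian a n u w‖ + ‖wronskian a n v w‖ with hS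
  set f : ℕ → ℂ := z • u - matrixAct a b u with hf
  set g : ℕ → ℂ := z • v - matrixAct a b v with hg
  have hf2 : Memℓp f 2 := (hu.1.const_smul z).sub hu.2
  have hg2 : Memℓp g 2 := (hv.1.const_smul z).sub hv.2
  have hSnn : ∀ n, 0 ≤ S n := fun n => by positivity
  have hwle : ∀ n ≥ N, ‖w (n + 1)‖ ≤ S n * (c⁻¹ * (‖u (n + 1)‖ + ‖v (n + 1)‖)) := fun n hn => by
    -- Cramer's rule: `u` and `v` are asymptotically independent, so `w` is recovered from its
    -- Wronskians with them.
    have hid : wronskian a n u v * w (n + 1) =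
        wronskian a n u w * v (n + 1) - wronskian a n v w * u (n + 1) := by
      simp only [wronskian]
      ring
    have h1 : c * ‖w (n + 1)‖ ≤ S n * (‖u (n + 1)‖ + ‖v (n + 1)‖) :=
      calc c * ‖w (n + 1)‖ ≤ ‖wronskian a n u v * w (n + 1)‖ := by
            rw [norm_mul]; exact mul_le_mul_of_nonneg_right (hN n hn) (norm_nonneg _)
        _ ≤ ‖wronskian a n u w‖ * ‖v (n + 1)‖ + ‖wronskian a n v w‖ * ‖u (n + 1)‖ := by
            rw [hid, ← norm_mul, ← norm_mul]; exact norm_sub_le _ _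
        _ ≤ _ := by
            simp only [hS]
            nlinarith [mul_nonneg (norm_nonneg (wronskian a n u w)) (norm_nonneg (u (n + 1))),
              mul_nonneg (norm_nonneg (wronskian a n v w)) (norm_nonneg (v (n + 1)))]
    have h2 : ‖w (n + 1)‖ ≤ c⁻¹ * (S n * (‖u (n + 1)‖ + ‖v (n + 1)‖)) := by
      rw [le_inv_mul_iff₀ hcpos]; exact h1
    linarith
  -- The Wronskian of `x` with the solution `w` changes only through the defect `z x - 𝒥x`, which is
  -- in `ℓ²` for `x = u, v`.
  have hstep : ∀ (x : ℕ → ℂ) (n : ℕ), ‖wronskian a (n + 1) x w‖ ≤ ‖wronskian a n x w‖ +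
      ‖(z • x - matrixAct a b x) (n + 1)‖ * ‖w (n + 1)‖ := fun x n => by
    rw [wronskian_succ (b := b), ← norm_mul]
    refine (norm_add_le _ _).trans_eq ?_
    congr 2
    simp only [greenTerm, hw, Pi.sub_apply, Pi.smul_apply, smul_eq_mul]
    ring
  set ε : ℕ → ℝ := fun n => c⁻¹ * ((‖f n‖ * ‖u n‖ + ‖f n‖ * ‖v n‖) +
    (‖g n‖ * ‖u n‖ + ‖g n‖ * ‖v n‖)) with hε
  have hεsum : Summable ε :=
    (((summable_norm_mul_norm hf2 hu.1).add (summable_norm_mul_norm hf2 hv.1)).add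
      ((summable_norm_mul_norm hg2 hu.1).add (summable_norm_mul_norm hg2 hv.1))).mul_left _
  have hεnn : ∀ n, 0 ≤ ε n := fun n => by positivity
  obtain ⟨C, hC⟩ : ∃ C, ∀ n, S (n + N) ≤ C := by
    refine bounded_of_le_mul_one_add (ε := fun n => ε (n + N + 1)) (fun n => hSnn _)
      (fun n => hεnn _) ((summable_nat_add_iff (N + 1)).2 hεsum) fun n => ?_
    have h1 := hwle (n + N) (by omega)
    have h2 := hstep u (n + N)
    have h3 := hstep v (n + N)
    rw [← hf] at h2
    rw [← hg] at h3
    rw [show n + 1 + N = n + N + 1 by omega]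
    generalize n + N = m at *
    calc S (m + 1) ≤ S m + (‖f (m + 1)‖ + ‖g (m + 1)‖) * ‖w (m + 1)‖ := by
          simp only [hS]; linarith
      _ ≤ S m + (‖f (m + 1)‖ + ‖g (m + 1)‖) *
          (S m * (c⁻¹ * (‖u (m + 1)‖ + ‖v (m + 1)‖))) := by gcongr
      _ = S m * (1 + ε (m + 1)) := by simp only [hε]; ring
  have hC0 : 0 ≤ C := (hSnn _).trans (hC 0)
  -- The factor 2 comes from `(s + t)² ≤ 2 (s² + t²)`.
  have hsq := ((memℓp_two_iff.1 hu.1).add (memℓp_two_iff.1 hv.1)).mul_left (2 * (C * c⁻¹) ^ 2)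
  rw [← summable_nat_add_iff (N + 1)] at hsq
  rw [memℓp_two_iff, ← summable_nat_add_iff (N + 1)]
  refine Summable.of_nonneg_of_le (fun n => by positivity) (fun n => ?_) hsq
  have h1 : ‖w (n + N + 1)‖ ≤ C * c⁻¹ * (‖u (n + N + 1)‖ + ‖v (n + N + 1)‖) := by
    refine (hwle (n + N) (by omega)).trans ?_
    rw [mul_assoc]
    exact mul_le_mul_of_nonneg_right (hC n) (by positivity)
  have h2 := pow_le_pow_left₀ (norm_nonneg _) h1 2
  rw [show n + (N + 1) = n + N + 1 by omega]
  refine h2.trans ?_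
  rw [mul_pow]
  nlinarith [mul_nonneg (sq_nonneg (C * c⁻¹)) (sq_nonneg (‖u (n + N + 1)‖ - ‖v (n + N + 1)‖))]

/-! ### The fundamental solutions -/

theorem ne_zero_of_pos (ha : ∀ n, 0 < a n) (n : ℕ) : (a n : ℂ) ≠ 0 :=
  Complex.ofReal_ne_zero.2 (ha n).ne'

theorem matrixAct_p (ha : ∀ n, 0 < a n) (z : ℂ) : matrixAct a b (p a b z) = z • p a b z := by
  funext n
  have h := ne_zero_of_pos ha n
  cases n with
  | zero => simp only [matrixAct_zero, p, Pi.smul_apply, smul_eq_mul]; field_simp; ring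
  | succ n => simp only [matrixAct_succ, p, Pi.smul_apply, smul_eq_mul]; field_simp; ring

theorem matrixAct_q_succ (ha : ∀ n, 0 < a n) (z : ℂ) (n : ℕ) :
    matrixAct a b (q a b z) (n + 1) = z * q a b z (n + 1) := by
  have h := ne_zero_of_pos ha (n + 1)
  simp only [matrixAct_succ, q]; field_simp; ring

theorem wronskian_p_q (ha : ∀ n, 0 < a n) (z : ℂ) (n : ℕ) :
    wronskian a n (p a b z) (q a b z) = 1 := by
  induction n with
  | zero =>
    have h := ne_zero_of_pos ha 0
    simp only [wronskian, p, q]; field_simp; ring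
  | succ n ih =>
    rw [wronskian_succ (b := b), ih, greenTerm, matrixAct_q_succ ha, matrixAct_p ha]
    simp only [Pi.smul_apply, smul_eq_mul]
    ring

/-- A formal eigensequence is determined by its value at zero. -/
theorem eq_smul_p (ha : ∀ n, 0 < a n) {z : ℂ} {u : ℕ → ℂ} (hu : matrixAct a b u = z • u) :
    u = u 0 • p a b z := by
  have key : ∀ n, u n = u 0 * p a b z n ∧ u (n + 1) = u 0 * p a b z (n + 1) := by
    intro n
    induction n with
    | zero =>
      have h := ne_zero_of_pos ha 0
      have h1 := congrFun hu 0
      simp only [matrixAct_zero, Pi.smul_apply, smul_eq_mul] at h1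
      refine ⟨by simp [p], ?_⟩
      simp only [p]
      field_simp
      linear_combination h1
    | succ n ih =>
      have h := ne_zero_of_pos ha (n + 1)
      have h1 := congrFun hu (n + 1)
      simp only [matrixAct_succ, Pi.smul_apply, smul_eq_mul] at h1
      refine ⟨ih.2, ?_⟩
      rw [ih.1, ih.2] at h1
      simp only [p]
      field_simp
      linear_combination h1
  funext n
  simpa using (key n).1

theorem exists_dual_eq_zero_of_notMem_of_isClosed {E : Type*} [NormedAddCommGroup E]
    [NormedSpace ℂ E] {S : Submodule ℂ E} (hS : IsClosed (S : Set E)) {x : E} (hx : x ∉ S) :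
    ∃ f : StrongDual ℂ E, (∀ y ∈ S, f y = 0) ∧ f x ≠ 0 := by
  let : NormedSpace ℝ E := NormedSpace.restrictScalars ℝ ℂ E
  obtain ⟨f, s, hf1, hf2⟩ := RCLike.geometric_hahn_banach_closed_point (𝕜 := ℂ)
    (S.restrictScalars ℝ).convex hS hx
  have h0 : 0 < s := by simpa using hf1 0 S.zero_mem
  refine ⟨f, fun y hy => ?_, fun h => ?_⟩
  · by_contra hne
    -- On this multiple of `y` the functional equals `s`, against the strict bound by `s` on the
    -- subspace.
    have h1 := hf1 _ (S.smul_mem ((s : ℂ) * (f y)⁻¹) hy)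
    rw [map_smul, smul_eq_mul, mul_assoc, inv_mul_cancel₀ hne] at h1
    simp at h1
  · rw [h] at hf2
    simp at hf2
    linarith

/-! ### The maximal operator and the closure of the minimal operator -/

theorem mem_domain_Jmax {u : L2} : u ∈ (Jmax a b).domain ↔ IsMaximal a b u :=
  ⟨fun h => ⟨lp.memℓp u, h⟩, fun h => h.2⟩

theorem Jmax_apply (u : (Jmax a b).domain) (n : ℕ) :
    (Jmax a b u : ℕ → ℂ) n = matrixAct a b (u : L2) n := rfl

/-- The form is kept bilinear so that it is a limit of Wronskians; conjugating one argument recovers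
the sesquilinear form that measures symmetry. -/
theorem boundaryForm_star_eq_inner (u v : (Jmax a b).domain) :
    boundaryForm a b (star ((u : L2) : ℕ → ℂ)) ((v : L2) : ℕ → ℂ) =
      inner ℂ (u : L2) (Jmax a b v) - inner ℂ (Jmax a b u) (v : L2) := by
  have h := (lp.hasSum_inner (𝕜 := ℂ) (u : L2) (Jmax a b v)).sub
    (lp.hasSum_inner (𝕜 := ℂ) (Jmax a b u) (v : L2))
  rw [← h.tsum_eq, boundaryForm]
  refine tsum_congr fun k => ?_
  simp only [greenTerm, matrixAct_star, RCLike.inner_apply, Jmax_apply, Pi.star_apply,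
    RCLike.star_def]
  ring

theorem mem_graph_Jmax {x : L2 × L2} :
    x ∈ (Jmax a b).graph ↔ ∀ n, matrixAct a b x.1 n = x.2 n := by
  rw [LinearPMap.mem_graph_iff]
  constructor
  · rintro ⟨y, hy1, hy2⟩ n
    rw [← hy1, ← hy2]
    rfl
  · intro h
    have h' : matrixAct a b x.1 = x.2 := funext h
    refine ⟨⟨x.1, ?_⟩, rfl, lp.ext h'⟩
    change Memℓp (matrixAct a b x.1) 2
    rw [h']
    exact lp.memℓp x.2

theorem continuous_apply_lp (n : ℕ) : Continuous fun u : L2 => (u : ℕ → ℂ) n :=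
  (lp.lipschitzWith_one_eval 2 n).continuous

/-- Each row of the matrix involves at most three components, and these are continuous on `ℓ²`; the
graph is an intersection of closed conditions. -/
theorem isClosed_Jmax : (Jmax a b).IsClosed := by
  have h : ((Jmax a b).graph : Set (L2 × L2)) =
      ⋂ n, {x : L2 × L2 | matrixAct a b x.1 n = x.2 n} := by
    ext x
    simp only [SetLike.mem_coe, mem_graph_Jmax, Set.mem_iInter, Set.mem_ofPred_eq]
  rw [LinearPMap.IsClosed, h]
  refine isClosed_iInter fun n => isClosed_eq ?_ ((continuous_apply_lp n).comp continuous_snd)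
  have hc := fun k => (continuous_apply_lp k).comp (continuous_fst (X := L2) (Y := L2))
  cases n with
  | zero =>
    exact (continuous_const.mul (hc 0)).add (continuous_const.mul (hc 1))
  | succ n =>
    exact ((continuous_const.mul (hc n)).add (continuous_const.mul (hc (n + 1)))).add
      (continuous_const.mul (hc (n + 2)))

theorem Jmin_le_Jmax : Jmin a b ≤ Jmax a b :=
  ⟨finSupp_le_domain_Jmax a b, fun x y hxy => by
    have h : Submodule.inclusion (finSupp_le_domain_Jmax a b) x = y := Subtype.ext hxy
    rw [← h]
    rfl⟩

theorem isClosable_Jmin : (Jmin a b).IsClosable :=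
  isClosed_Jmax.isClosable.leIsClosable Jmin_le_Jmax

theorem closure_Jmin_le_Jmax : (Jmin a b).closure ≤ Jmax a b := by
  have h := isClosed_Jmax.isClosable.closure_mono (Jmin_le_Jmax (a := a) (b := b))
  refine h.trans_eq (LinearPMap.eq_of_eq_graph ?_)
  rw [← isClosed_Jmax.isClosable.graph_closure_eq_closure_graph]
  exact IsClosed.submodule_topologicalClosure_eq isClosed_Jmax

/-- The unit vectors. -/
noncomputable def unitVec (n : ℕ) : L2 := lp.single 2 n 1

theorem unitVec_mem_finSupp (n : ℕ) : unitVec n ∈ finSupp := by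
  refine (Set.finite_singleton n).subset fun k hk => ?_
  by_contra h
  exact hk (lp.single_apply_ne 2 n 1 h)

/-- The Wronskian vanishes beyond the support of `e`; hence no summability of `v` is needed. -/
theorem sum_greenTerm_finSupp (v : ℕ → ℂ) {e : L2} (he : e ∈ finSupp) :
    HasSum (greenTerm a b v e) 0 := by
  obtain ⟨N, hN⟩ := Set.Finite.bddAbove he
  have hz : ∀ n, N < n → (e : ℕ → ℂ) n = 0 := fun n hn => by
    by_contra h
    exact absurd (hN h) (not_le.mpr hn)
  have h := hasSum_sum_of_ne_finset_zero (f := greenTerm a b v e)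
    (L := .unconditional ℕ) (s := Finset.range (N + 1 + 1)) fun k hk => by
      rw [Finset.mem_range, not_lt] at hk
      obtain ⟨m, rfl⟩ : ∃ m, k = m + 1 := ⟨k - 1, by omega⟩
      simp [greenTerm, matrixAct_succ, hz m (by omega), hz (m + 1) (by omega),
        hz (m + 2) (by omega)]
  rw [sum_greenTerm] at h
  simpa [wronskian, hz (N + 1) (by omega), hz (N + 2) (by omega)] using h

/-- For fixed `v` the form is continuous in the graph norm and vanishes on the graph of `Jmin`,
hence on its closure. -/
theorem boundaryForm_closure_eq_zero {u : L2} (hu : u ∈ (Jmin a b).closure.domain) {v : ℕ → ℂ}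
    (hv : IsMaximal a b v) : boundaryForm a b v u = 0 := by
  set x : L2 := star ⟨v, hv.1⟩ with hx
  set y : L2 := star ⟨matrixAct a b v, hv.2⟩ with hy
  have key : ∀ w : L2 × L2, HasSum (fun k => v k * w.2 k - matrixAct a b v k * w.1 k)
      (inner ℂ x w.2 - inner ℂ y w.1) := fun w => by
    have h := (lp.hasSum_inner (𝕜 := ℂ) x w.2).sub (lp.hasSum_inner (𝕜 := ℂ) y w.1)
    refine h.congr_fun ?_
    intro k
    simp [hx, hy, RCLike.inner_apply, mul_comm]
  have hclosed : IsClosed {w : L2 × L2 | inner ℂ x w.2 - inner ℂ y w.1 = 0} :=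
    isClosed_eq (by fun_prop) continuous_const
  have hsub : ((Jmin a b).graph : Set (L2 × L2)) ⊆
      {w : L2 × L2 | inner ℂ x w.2 - inner ℂ y w.1 = 0} := by
    intro w hw
    obtain ⟨e, he1, he2⟩ := LinearPMap.mem_graph_iff _ |>.1 hw
    have h := sum_greenTerm_finSupp (a := a) (b := b) v e.2
    refine (key w).unique ?_
    rw [← he1, ← he2]
    exact h
  have hmem : (u, (Jmin a b).closure ⟨u, hu⟩) ∈ (Jmin a b).closure.graph :=
    LinearPMap.mem_graph _ ⟨u, hu⟩
  have hval : (Jmin a b).closure ⟨u, hu⟩ = Jmax a b ⟨u, closure_Jmin_le_Jmax.1 hu⟩ :=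
    closure_Jmin_le_Jmax.2 rfl
  rw [← isClosable_Jmin.graph_closure_eq_closure_graph] at hmem
  have h := closure_minimal hsub hclosed hmem
  rw [hval] at h
  have h2 := key (u, Jmax a b ⟨u, closure_Jmin_le_Jmax.1 hu⟩)
  rw [show inner ℂ x (Jmax a b ⟨u, closure_Jmin_le_Jmax.1 hu⟩) - inner ℂ y u = 0 from h] at h2
  exact h2.tsum_eq

/-- Otherwise Hahn–Banach separates `(u, 𝒥u)` from the closed graph. Testing the functional on unit
vectors shows that it is `(w₁, w₂) ↦ ∑ (v w₂ - 𝒥v w₁)` with `v` maximal, so its value at `(u, 𝒥u)`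
is `[v, u] = 0`. -/
theorem mem_closure_domain_of_boundaryForm {u : L2} (hu : IsMaximal a b u)
    (h : ∀ v, IsMaximal a b v → boundaryForm a b v u = 0) : u ∈ (Jmin a b).closure.domain := by
  set S := (Jmin a b).graph.topologicalClosure with hS
  set J := Jmax a b ⟨u, mem_domain_Jmax.2 hu⟩ with hJ
  suffices hmem : (u, J) ∈ S by
    rw [hS, isClosable_Jmin.graph_closure_eq_closure_graph] at hmem
    obtain ⟨y, hy1, -⟩ := (LinearPMap.mem_graph_iff _).1 hmem
    have hy1' : (y : L2) = u := hy1
    exact hy1' ▸ y.2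
  by_contra hnot
  obtain ⟨f, hf1, hf2⟩ := exists_dual_eq_zero_of_notMem_of_isClosed
    (Submodule.isClosed_topologicalClosure (Jmin a b).graph) hnot
  set x : L2 := star ((InnerProductSpace.toDual ℂ L2).symm (f.comp (.inl ℂ L2 L2))) with hx
  set v : L2 := star ((InnerProductSpace.toDual ℂ L2).symm (f.comp (.inr ℂ L2 L2))) with hv
  have hf : ∀ w : L2 × L2, HasSum (fun k => v k * w.2 k + x k * w.1 k) (f w) := fun w => by
    have h := (lp.hasSum_inner (𝕜 := ℂ) (star v) w.2).add (lp.hasSum_inner (𝕜 := ℂ) (star x) w.1)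
    have h2 : inner ℂ (star v) w.2 + inner ℂ (star x) w.1 = f w := by
      rw [hv, hx, star_star, star_star, InnerProductSpace.toDual_symm_apply,
        InnerProductSpace.toDual_symm_apply, ContinuousLinearMap.comp_apply,
        ContinuousLinearMap.comp_apply, ← map_add]
      simp
    rw [h2] at h
    refine h.congr_fun ?_
    intro k
    simp [RCLike.inner_apply, mul_comm]
  have hxv : ∀ n, matrixAct a b v n = -x n := fun n => by
    have h1 := hf (unitVec n, Jmin a b ⟨unitVec n, unitVec_mem_finSupp n⟩)
    rw [hf1 _ (Submodule.le_topologicalClosure _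
      (LinearPMap.mem_graph _ ⟨unitVec n, unitVec_mem_finSupp n⟩))] at h1
    have h2 := h1.sub (sum_greenTerm_finSupp (a := a) (b := b) v (unitVec_mem_finSupp n))
    have h3 : HasSum (fun k => (x k + matrixAct a b v k) * unitVec n k) 0 := by
      rw [sub_zero] at h2
      refine h2.congr_fun ?_
      intro k
      simp only [greenTerm]
      change _ = v k * matrixAct a b (unitVec n) k + x k * unitVec n k - _
      ring
    have h4 := h3.unique (hasSum_single n fun k hk => by
      rw [unitVec, lp.single_apply_ne 2 n 1 hk, mul_zero])
    rw [unitVec, lp.single_apply_self, mul_one] at h4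
    linear_combination -h4
  have hvmax : IsMaximal a b v := by
    refine ⟨lp.memℓp v, ?_⟩
    rw [show matrixAct a b v = -x from funext hxv]
    exact (lp.memℓp x).neg
  apply hf2
  rw [← h v hvmax, boundaryForm]
  refine (hf _).tsum_eq.symm.trans (tsum_congr fun k => ?_)
  simp only [greenTerm, hxv]
  change v k * matrixAct a b u k + _ = _
  ring

theorem exists_boundaryForm_ne_zero (hLC : (Jmin a b).closure ≠ Jmax a b) :
    ∃ u v, IsMaximal a b u ∧ IsMaximal a b v ∧ boundaryForm a b u v ≠ 0 := by
  by_contra! hcon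
  refine hLC (LinearPMap.eq_of_le_of_domain_eq closure_Jmin_le_Jmax
    (le_antisymm closure_Jmin_le_Jmax.1 fun u hu => ?_))
  exact mem_closure_domain_of_boundaryForm (mem_domain_Jmax.1 hu)
    fun v hv => hcon v u hv (mem_domain_Jmax.1 hu)

/-! ### Restrictions of the maximal operator by one boundary condition -/

/-- `J` is a symmetric restriction of the maximal operator to the kernel of a nonzero boundary
functional. -/
structure IsBoundaryRestriction (a b : ℕ → ℝ) (J : L2 →ₗ.[ℂ] L2) (g : ℕ → ℂ) : Prop where
  le_Jmax : J ≤ Jmax a b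
  isMaximal : IsMaximal a b g
  exists_ne_zero : ∃ w, IsMaximal a b w ∧ boundaryForm a b g w ≠ 0
  mem_domain_iff : ∀ u : L2, u ∈ J.domain ↔ IsMaximal a b u ∧ boundaryForm a b g u = 0
  isFormalAdjoint : J.IsFormalAdjoint J

theorem apply_eq_of_le_Jmax {J : L2 →ₗ.[ℂ] L2} (hJ : J ≤ Jmax a b) (u : J.domain) :
    ((J u : L2) : ℕ → ℂ) = matrixAct a b (u : L2) := by
  have h : J u = Jmax a b ⟨u, hJ.1 u.2⟩ := hJ.2 rfl
  rw [h]
  rfl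

theorem isFormalAdjoint_iff_boundaryForm {J : L2 →ₗ.[ℂ] L2} (hJ : J ≤ Jmax a b) :
    J.IsFormalAdjoint J ↔ ∀ u ∈ J.domain, ∀ v ∈ J.domain,
      boundaryForm a b (star (u : ℕ → ℂ)) v = 0 := by
  have key : ∀ u v : J.domain, boundaryForm a b (star ((u : L2) : ℕ → ℂ)) (v : L2) =
      inner ℂ (u : L2) (J v) - inner ℂ (J u) (v : L2) := fun u v => by
    have hu : J u = Jmax a b ⟨u, hJ.1 u.2⟩ := hJ.2 rfl
    have hv : J v = Jmax a b ⟨v, hJ.1 v.2⟩ := hJ.2 rfl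
    rw [hu, hv]
    exact boundaryForm_star_eq_inner ⟨u, hJ.1 u.2⟩ ⟨v, hJ.1 v.2⟩
  constructor
  · intro h u hu v hv
    rw [key ⟨u, hu⟩ ⟨v, hv⟩, h ⟨u, hu⟩ ⟨v, hv⟩, sub_self]
  · intro h u v
    have h1 := key u v
    rw [h u u.2 v v.2] at h1
    exact (sub_eq_zero.1 h1.symm).symm

theorem boundaryForm_star_eq_zero_iff (u v : ℕ → ℂ) :
    boundaryForm a b (star u) v = 0 ↔ boundaryForm a b u (star v) = 0 := by
  conv_lhs => rw [← star_star v, boundaryForm_star, star_eq_zero]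

/-! ### The boundary condition defining `Jt` -/

theorem isMaximal_boundarySeq (ha : ∀ n, 0 < a n) (hLC : (Jmin a b).closure ≠ Jmax a b)
    (t : OnePoint ℝ) : IsMaximal a b (boundarySeq a b t) := by
  obtain ⟨u, v, hu, hv, huv⟩ := exists_boundaryForm_ne_zero hLC
  refine IsMaximal.of_eigen (z := 0) (memℓp_of_eigen hu hv huv (z := 0) ?_) ?_ <;>
  · intro n
    induction t using OnePoint.rec with
    | infty =>
      have h : boundarySeq a b OnePoint.infty = p a b 0 := rfl
      rw [h, matrixAct_p ha]
      rfl
    | coe s =>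
      have h : boundarySeq a b s = (s : ℂ) • p a b 0 + q a b 0 := rfl
      rw [h, map_add, map_smul, matrixAct_p ha, Pi.add_apply, matrixAct_q_succ ha]
      simp

theorem boundaryForm_p_q (ha : ∀ n, 0 < a n) {z : ℂ} (hp : IsMaximal a b (p a b z))
    (hq : IsMaximal a b (q a b z)) : boundaryForm a b (p a b z) (q a b z) = 1 :=
  tendsto_nhds_unique (hp.tendsto_wronskian hq)
    (tendsto_const_nhds.congr fun n => (wronskian_p_q ha z n).symm)

theorem isMaximal_p (ha : ∀ n, 0 < a n) (hLC : (Jmin a b).closure ≠ Jmax a b) (z : ℂ) :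
    IsMaximal a b (p a b z) := by
  obtain ⟨u, v, hu, hv, huv⟩ := exists_boundaryForm_ne_zero hLC
  have h : ∀ n, matrixAct a b (p a b z) (n + 1) = z * p a b z (n + 1) := fun n => by
    rw [matrixAct_p ha]; rfl
  exact IsMaximal.of_eigen (memℓp_of_eigen hu hv huv h) h

theorem isMaximal_q (ha : ∀ n, 0 < a n) (hLC : (Jmin a b).closure ≠ Jmax a b) (z : ℂ) :
    IsMaximal a b (q a b z) := by
  obtain ⟨u, v, hu, hv, huv⟩ := exists_boundaryForm_ne_zero hLC
  exact IsMaximal.of_eigen (memℓp_of_eigen hu hv huv (matrixAct_q_succ ha z))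
    (matrixAct_q_succ ha z)

theorem exists_boundarySeq_ne_zero (ha : ∀ n, 0 < a n) (hLC : (Jmin a b).closure ≠ Jmax a b)
    (t : OnePoint ℝ) :
    ∃ w, IsMaximal a b w ∧ boundaryForm a b (boundarySeq a b t) w ≠ 0 := by
  have hp := isMaximal_p ha hLC 0
  have hq := isMaximal_q ha hLC 0
  have hpq := boundaryForm_p_q ha hp hq
  induction t using OnePoint.rec with
  | infty => exact ⟨_, hq, by simpa [boundarySeq] using hpq ▸ one_ne_zero⟩
  | coe s =>
    refine ⟨_, hp, ?_⟩
    have h : boundarySeq a b s = (s : ℂ) • p a b 0 + q a b 0 := rfl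
    rw [boundaryForm_swap, h, boundaryForm_add_right hp (hp.smul s) hq, boundaryForm_smul_right,
      boundaryForm_self, hpq]
    simp

theorem star_p_zero (n : ℕ) : star (p a b 0 n) = p a b 0 n := by
  induction n using p.induct with
  | case1 => simp [p]
  | case2 => simp [p]
  | case3 n ih1 ih2 => simp only [p, star_div₀, star_sub, star_mul', ih1, ih2]; simp

theorem star_q_zero (n : ℕ) : star (q a b 0 n) = q a b 0 n := by
  induction n using q.induct with
  | case1 => simp [q]
  | case2 => simp [q]
  | case3 n ih1 ih2 => simp only [q, star_div₀, star_sub, star_mul', ih1, ih2]; simp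

theorem star_boundarySeq (t : OnePoint ℝ) : star (boundarySeq a b t) = boundarySeq a b t := by
  funext n
  induction t using OnePoint.rec with
  | infty => exact star_p_zero n
  | coe s =>
    change star ((s : ℂ) * p a b 0 n + q a b 0 n) = (s : ℂ) * p a b 0 n + q a b 0 n
    rw [star_add, star_mul', star_p_zero, star_q_zero]
    simp

theorem mem_domain_Jt_iff (ha : ∀ n, 0 < a n) (hLC : (Jmin a b).closure ≠ Jmax a b)
    (t : OnePoint ℝ) (u : L2) : u ∈ (Jt a b t).domain ↔
      IsMaximal a b u ∧ boundaryForm a b (boundarySeq a b t) u = 0 := by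
  have hg := isMaximal_boundarySeq ha hLC t
  set g : L2 := ⟨boundarySeq a b t, hg.1⟩ with hg_def
  have hspan : {f : L2 | (f : ℕ → ℂ) = boundarySeq a b t} = {g} := by
    ext f
    exact ⟨fun h => lp.ext h, fun h => by rw [h]; rfl⟩
  have hdom : u ∈ (Jt a b t).domain ↔
      u ∈ (Jmin a b).closure.domain ⊔ Submodule.span ℂ {g} ∧ u ∈ (Jmax a b).domain := by
    rw [← hspan]
    exact Submodule.mem_inf
  rw [hdom, mem_domain_Jmax]
  constructor
  · rintro ⟨h, hu⟩
    refine ⟨hu, ?_⟩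
    obtain ⟨x, hx, y, hy, rfl⟩ := Submodule.mem_sup.1 h
    obtain ⟨c, rfl⟩ := Submodule.mem_span_singleton.1 hy
    have h1 := boundaryForm_closure_eq_zero hx hg
    have hxm : IsMaximal a b x := mem_domain_Jmax.1 (closure_Jmin_le_Jmax.1 hx)
    rw [lp.coeFn_add, lp.coeFn_smul, boundaryForm_add_right hg hxm (hg.smul c), h1,
      boundaryForm_smul_right, boundaryForm_self]
    simp
  · rintro ⟨hu, hgu⟩
    refine ⟨?_, hu⟩
    obtain ⟨w, hw, hgw⟩ := exists_boundarySeq_ne_zero ha hLC t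
    -- With this `c` both `[w, ·]` and `[g, ·]` annihilate `u - c g`; as `[g, w] ≠ 0`, the Plücker
    -- relation puts it in the radical.
    set c : ℂ := boundaryForm a b w u / boundaryForm a b w (boundarySeq a b t) with hc
    have hwg : boundaryForm a b w (boundarySeq a b t) ≠ 0 := by
      rw [boundaryForm_swap]
      simpa using hgw
    have hxm : IsMaximal a b ((u - c • g : L2) : ℕ → ℂ) := hu.sub (hg.smul c)
    have hx1 : boundaryForm a b w ((u - c • g : L2) : ℕ → ℂ) = 0 := by
      rw [lp.coeFn_sub, lp.coeFn_smul, boundaryForm_sub_right hw hu (hg.smul c),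
        boundaryForm_smul_right]
      rw [hc, div_mul_cancel₀ _ hwg, sub_self]
    have hx2 : boundaryForm a b (boundarySeq a b t) ((u - c • g : L2) : ℕ → ℂ) = 0 := by
      rw [lp.coeFn_sub, lp.coeFn_smul, boundaryForm_sub_right hg hu (hg.smul c),
        boundaryForm_smul_right, hgu]
      rw [boundaryForm_self]
      ring
    have hx : u - c • g ∈ (Jmin a b).closure.domain := by
      refine mem_closure_domain_of_boundaryForm hxm fun v hv => ?_
      have h := boundaryForm_plucker hg hw hxm hv
      rw [hx1, hx2] at h
      rw [boundaryForm_swap]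
      simpa [hgw] using h
    exact Submodule.mem_sup.2 ⟨_, hx, c • g, Submodule.smul_mem _ c
      (Submodule.mem_span_singleton_self g), sub_add_cancel _ _⟩

theorem isBoundaryRestriction_Jt (ha : ∀ n, 0 < a n) (hLC : (Jmin a b).closure ≠ Jmax a b)
    (t : OnePoint ℝ) : IsBoundaryRestriction a b (Jt a b t) (boundarySeq a b t) where
  le_Jmax := LinearPMap.domRestrict_le
  isMaximal := isMaximal_boundarySeq ha hLC t
  exists_ne_zero := exists_boundarySeq_ne_zero ha hLC t
  mem_domain_iff := mem_domain_Jt_iff ha hLC t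
  isFormalAdjoint := by
    refine (isFormalAdjoint_iff_boundaryForm LinearPMap.domRestrict_le).2 ?_
    intro u hu v hv
    replace hu := (mem_domain_Jt_iff ha hLC t u).1 hu
    replace hv := (mem_domain_Jt_iff ha hLC t v).1 hv
    obtain ⟨w, hw, hgw⟩ := exists_boundarySeq_ne_zero ha hLC t
    refine boundaryForm_eq_zero (isMaximal_boundarySeq ha hLC t) hw hgw hu.1.star hv.1 ?_ hv.2
    rw [← boundaryForm_star_eq_zero_iff, star_boundarySeq, hu.2]

/-! ### Self-adjoint extensions of the minimal operator -/

theorem dense_finSupp : Dense (finSupp : Set L2) := by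
  intro u
  have h := lp.hasSum_single (p := 2) (by norm_num) u
  refine mem_closure_of_tendsto h (Eventually.of_forall fun s => ?_)
  refine Submodule.sum_mem _ fun n _ => ?_
  refine (Set.finite_singleton n).subset fun k hk => ?_
  by_contra hne
  exact hk (lp.single_apply_ne 2 n _ hne)

/-- A formal adjoint of the minimal operator is a restriction of the maximal operator. -/
theorem le_Jmax_of_isFormalAdjoint {J : L2 →ₗ.[ℂ] L2} (hJ : J.IsFormalAdjoint (Jmin a b)) :
    J ≤ Jmax a b := by
  have key : ∀ (u : J.domain) (n : ℕ), matrixAct a b (u : L2) n = J u n := fun u n => by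
    set e : (Jmin a b).domain := ⟨unitVec n, unitVec_mem_finSupp n⟩ with he
    have h1 := hJ u e
    have h2 : HasSum (fun k => star ((u : L2) : ℕ → ℂ) k * matrixAct a b (unitVec n) k)
        (inner ℂ (u : L2) (Jmin a b e)) := by
      refine (lp.hasSum_inner (𝕜 := ℂ) (u : L2) (Jmin a b e)).congr_fun fun k => ?_
      change _ = inner ℂ ((u : L2) k) (matrixAct a b (unitVec n) k)
      simp [RCLike.inner_apply, mul_comm]
    have h3 := h2.sub (sum_greenTerm_finSupp (a := a) (b := b) (star ((u : L2) : ℕ → ℂ))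
      (unitVec_mem_finSupp n))
    have h4 : HasSum (fun k => star (matrixAct a b (u : L2)) k * unitVec n k)
        (inner ℂ (u : L2) (Jmin a b e)) := by
      rw [sub_zero] at h3
      refine h3.congr_fun fun k => ?_
      rw [greenTerm, matrixAct_star]
      ring
    have h5 := h4.unique (hasSum_single n fun k hk => by
      rw [unitVec, lp.single_apply_ne 2 n 1 hk, mul_zero])
    rw [← h1] at h5
    have h6 : inner ℂ (J u) (unitVec n) = star (J u n) := by
      rw [unitVec, lp.inner_single_right]
      simp
    change inner ℂ (J u) (unitVec n) = _ at h5
    rw [h6, unitVec, lp.single_apply_self, mul_one] at h5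
    exact (star_injective h5).symm
  refine ⟨fun u hu => ?_, fun x y hxy => lp.ext (funext fun n => ?_)⟩
  · change Memℓp (matrixAct a b u) 2
    rw [show matrixAct a b u = J ⟨u, hu⟩ from funext (key ⟨u, hu⟩)]
    exact lp.memℓp _
  · rw [← key x n, hxy]
    rfl

/-- Every self-adjoint extension of the minimal operator is given by one boundary condition. -/
theorem exists_isBoundaryRestriction_of_isSelfAdjoint
    (hLC : (Jmin a b).closure ≠ Jmax a b) {J : L2 →ₗ.[ℂ] L2} (hJmin : Jmin a b ≤ J)
    (hJ : IsSelfAdjoint J) : ∃ g, IsBoundaryRestriction a b J g := by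
  have hdense : Dense (J.domain : Set L2) := dense_finSupp.mono hJmin.1
  have hsymm : J.IsFormalAdjoint J := by
    have h := LinearPMap.adjoint_isFormalAdjoint hdense
    rwa [LinearPMap.isSelfAdjoint_def.1 hJ] at h
  have hle : J ≤ Jmax a b := le_Jmax_of_isFormalAdjoint fun u e => by
    have h : Jmin a b e = J ⟨e, hJmin.1 e.2⟩ := hJmin.2 rfl
    rw [h]
    exact hsymm u ⟨e, hJmin.1 e.2⟩
  have hmax : ∀ u ∈ J.domain, IsMaximal a b u := fun u hu => mem_domain_Jmax.1 (hle.1 hu)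
  have hform := (isFormalAdjoint_iff_boundaryForm hle).1 hsymm
  -- Such a `v` lies in the domain of the adjoint, which is `J` itself.
  have hmem : ∀ v : L2, IsMaximal a b v →
      (∀ u ∈ J.domain, boundaryForm a b (star (u : ℕ → ℂ)) v = 0) → v ∈ J.domain := by
    intro v hv h
    rw [← LinearPMap.isSelfAdjoint_def.1 hJ]
    refine LinearPMap.mem_adjoint_domain_of_exists v
      ⟨Jmax a b ⟨v, mem_domain_Jmax.2 hv⟩, fun u => ?_⟩
    have h1 := boundaryForm_star_eq_inner ⟨u, hle.1 u.2⟩ ⟨v, mem_domain_Jmax.2 hv⟩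
    have h2 : J u = Jmax a b ⟨u, hle.1 u.2⟩ := hle.2 rfl
    rw [h u u.2, ← h2] at h1
    rw [← inner_conj_symm, sub_eq_zero.1 h1.symm, inner_conj_symm]
  obtain ⟨g, hg, w, hw, hgw⟩ : ∃ g ∈ J.domain, ∃ w, IsMaximal a b w ∧
      boundaryForm a b (g : ℕ → ℂ) w ≠ 0 := by
    -- If every functional `[g, ·]` vanished, all maximal vectors would lie in the domain of `J`,
    -- and the whole form would be zero.
    by_contra! hcon
    have hall : ∀ v, IsMaximal a b v → ∃ v' ∈ J.domain, (v' : ℕ → ℂ) = v := fun v hv => by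
      refine ⟨⟨v, hv.1⟩, hmem _ hv fun u hu => ?_, rfl⟩
      rw [boundaryForm_star_eq_zero_iff]
      exact hcon u hu _ hv.star
    obtain ⟨u, v, hu, hv, huv⟩ := exists_boundaryForm_ne_zero hLC
    obtain ⟨u', hu', rfl⟩ := hall u hu
    exact huv (hcon u' hu' v hv)
  have hgm := hmax g hg
  have hgw' : boundaryForm a b (star (g : ℕ → ℂ)) (star w) ≠ 0 := by
    rw [boundaryForm_star]
    exact star_ne_zero.2 hgw
  refine ⟨star (g : ℕ → ℂ), hle, hgm.star, ⟨_, hw.star, hgw'⟩, fun v => ?_, hsymm⟩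
  refine ⟨fun hv => ⟨hmax v hv, hform g hg v hv⟩, fun ⟨hv, hgv⟩ => hmem v hv fun u hu => ?_⟩
  -- Isotropy is used twice: `g` and `v` lie in the kernel of `[star g, ·]`, and then `star u` and
  -- `v` lie in the kernel of `[g, ·]`.
  have h1 : boundaryForm a b (g : ℕ → ℂ) v = 0 :=
    boundaryForm_eq_zero hgm.star hw.star hgw' hgm hv (hform g hg g hg) hgv
  refine boundaryForm_eq_zero hgm hw hgw (hmax u hu).star hv ?_ h1
  rw [← boundaryForm_star_eq_zero_iff]
  exact hform g hg u hu

end Jacobi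

namespace UnboundedOp

universe u

variable {E : Type u} [NormedAddCommGroup E] [InnerProductSpace ℂ E]

/-! ### Symmetric operators with Hilbert-Schmidt resolvent -/

theorem IsEigenvalue.exists_norm_eq_one {T : E →ₗ.[ℂ] E} {z : ℂ} (h : IsEigenvalue T z) :
    ∃ u : T.domain, ‖(u : E)‖ = 1 ∧ T u = z • (u : E) := by
  obtain ⟨u, hu, hTu⟩ := h
  have hn : ‖(u : E)‖ ≠ 0 := by simpa using hu
  refine ⟨((‖(u : E)‖⁻¹ : ℝ) : ℂ) • u, ?_, ?_⟩
  · simp [norm_smul, hn]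
  · rw [LinearPMap.map_smul, hTu, smul_comm]
    rfl

theorem conj_eq_of_isEigenvalue {T : E →ₗ.[ℂ] E} (hT : T.IsFormalAdjoint T) {z : ℂ}
    (h : IsEigenvalue T z) : starRingEnd ℂ z = z := by
  obtain ⟨u, hu, hTu⟩ := h.exists_norm_eq_one
  have h1 := hT u u
  rw [hTu, inner_smul_left, inner_smul_right, inner_self_eq_norm_sq_to_K, hu] at h1
  simpa using h1

theorem inner_eq_zero_of_isFormalAdjoint {T : E →ₗ.[ℂ] E} (hT : T.IsFormalAdjoint T) {z w : ℂ}
    (hz : starRingEnd ℂ z = z) (hzw : z ≠ w) {u v : T.domain} (hu : T u = z • (u : E))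
    (hv : T v = w • (v : E)) : inner ℂ (u : E) (v : E) = 0 := by
  have h1 := hT u v
  rw [hu, hv, inner_smul_left, inner_smul_right, hz, ← sub_eq_zero, ← sub_mul] at h1
  exact (mul_eq_zero.1 h1).resolve_left (sub_ne_zero.2 hzw)

theorem _root_.HilbertBasis.hasSum_norm_inner_sq {ι : Type*} (f : HilbertBasis ι ℂ E) (x : E) :
    HasSum (fun i => ‖inner ℂ (f i) x‖ ^ 2) (‖x‖ ^ 2) := by
  have h := lp.hasSum_norm (p := 2) (by norm_num) (f.repr x)
  simpa [f.repr_apply_apply] using h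

/-- The diagonal of a Hilbert-Schmidt operator in an orthonormal family is square summable, with
a uniform bound. -/
theorem IsHilbertSchmidt.exists_sum_norm_inner_sq_le [CompleteSpace E] {A : E →L[ℂ] E}
    (hA : IsHilbertSchmidt A) :
    ∃ C : ℝ, ∀ (κ : Type) [Fintype κ] (e : κ → E), Orthonormal ℂ e →
      ∑ k, ‖inner ℂ (e k) (A (e k))‖ ^ 2 ≤ C := by
  obtain ⟨ι, f, hf⟩ := hA
  refine ⟨∑' i, ‖A (f i)‖ ^ 2, fun κ _ e he => ?_⟩
  -- Passing to the adjoint allows Parseval in the basis `f` for `B (e k)`, and then Bessel in the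
  -- family `e` for `A (f i)`.
  set B := ContinuousLinearMap.adjoint A with hB
  have h1 : ∀ k, ‖inner ℂ (e k) (A (e k))‖ ^ 2 ≤ ‖B (e k)‖ ^ 2 := fun k => by
    refine pow_le_pow_left₀ (norm_nonneg _) ?_ 2
    rw [← ContinuousLinearMap.adjoint_inner_left]
    refine (norm_inner_le_norm _ _).trans_eq ?_
    rw [he.1 k, mul_one]
  have h2 : HasSum (fun i => ∑ k, ‖inner ℂ (f i) (B (e k))‖ ^ 2) (∑ k, ‖B (e k)‖ ^ 2) :=
    hasSum_sum fun k _ => f.hasSum_norm_inner_sq (B (e k))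
  refine (Finset.sum_le_sum fun k _ => h1 k).trans (hasSum_le (fun i => ?_) h2 hf.hasSum)
  refine le_trans (Finset.sum_le_sum fun k _ => le_of_eq ?_)
    (he.sum_inner_products_le (A (f i)) (s := Finset.univ))
  rw [ContinuousLinearMap.adjoint_inner_right, norm_inner_symm]

/-- On an eigenvector `R` acts as `(z - z₀)⁻¹`, so each eigenvalue in the disc adds at least `1 /
r²` to a diagonal sum bounded by `C`. Hence there are at most `C r²` of them. -/
theorem finite_isEigenvalue [CompleteSpace E] {T : E →ₗ.[ℂ] E} (hT : T.IsFormalAdjoint T)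
    {z₀ : ℂ} {R : E →L[ℂ] E} (hR : IsResolventAt T z₀ R) (hHS : IsHilbertSchmidt R) (r : ℝ) :
    {z | IsEigenvalue T z ∧ ‖z - z₀‖ ≤ r}.Finite := by
  obtain ⟨C, hC⟩ := hHS.exists_sum_norm_inner_sq_le
  by_contra hinf
  obtain ⟨n, hn⟩ := exists_nat_gt (C * r ^ 2)
  obtain ⟨s, hs, hcard⟩ := Set.Infinite.exists_subset_card_eq hinf n
  have hex : ∀ z : s, ∃ u : T.domain, ‖(u : E)‖ = 1 ∧ T u = (z : ℂ) • (u : E) := fun z =>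
    (hs z.2).1.exists_norm_eq_one
  choose e he1 he2 using hex
  have horth : Orthonormal ℂ fun z : s => (e z : E) :=
    ⟨he1, fun z w hzw => inner_eq_zero_of_isFormalAdjoint hT
      (conj_eq_of_isEigenvalue hT (hs z.2).1) (fun h => hzw (Subtype.ext h)) (he2 z) (he2 w)⟩
  have hterm : ∀ z : s, 1 ≤ r ^ 2 * ‖inner ℂ (e z : E) (R (e z))‖ ^ 2 := fun z => by
    have h1 : R (((z : ℂ) - z₀) • (e z : E)) = e z := by
      rw [hR]
      exact ⟨(e z).2, by rw [sub_smul, ← he2 z]⟩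
    have h2 : ((z : ℂ) - z₀) * inner ℂ (e z : E) (R (e z)) = 1 := by
      rw [← inner_smul_right, ← map_smul, h1, inner_self_eq_norm_sq_to_K, he1 z]
      simp
    have h3 : ‖(z : ℂ) - z₀‖ * ‖inner ℂ (e z : E) (R (e z))‖ = 1 := by
      rw [← norm_mul, h2, norm_one]
    have h4 : 1 ≤ r * ‖inner ℂ (e z : E) (R (e z))‖ :=
      h3.symm.trans_le (mul_le_mul_of_nonneg_right (hs z.2).2 (norm_nonneg _))
    rw [← mul_pow]
    exact one_le_pow₀ h4
  have hsum : (n : ℝ) ≤ r ^ 2 * ∑ z : s, ‖inner ℂ (e z : E) (R (e z))‖ ^ 2 := by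
    rw [Finset.mul_sum, ← hcard]
    have h := Finset.sum_le_sum fun z (_ : z ∈ (Finset.univ : Finset s)) => hterm z
    simpa using h
  have h := hC s _ horth
  nlinarith [mul_le_mul_of_nonneg_left h (sq_nonneg r)]

theorem not_accPt_spectrum [CompleteSpace E] {T : E →ₗ.[ℂ] E} (hT : T.IsFormalAdjoint T)
    {z₀ : ℂ} {R : E →L[ℂ] E} (hR : IsResolventAt T z₀ R) (hHS : IsHilbertSchmidt R)
    (hspec : ∀ z ∈ spectrum T, IsEigenvalue T z) (z : ℂ) :
    ¬ AccPt z (Filter.principal (spectrum T)) := by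
  intro hacc
  have h1 := hacc.nhds_inter (Metric.ball_mem_nhds z one_pos)
  refine Set.Infinite.mono (s := Metric.ball z 1 ∩ spectrum T) ?_ (Set.Infinite.of_accPt h1)
    (finite_isEigenvalue hT hR hHS (1 + ‖z - z₀‖))
  rintro w ⟨hw1, hw2⟩
  refine ⟨hspec w hw2, ?_⟩
  rw [Metric.mem_ball, dist_eq_norm] at hw1
  calc ‖w - z₀‖ = ‖(w - z) + (z - z₀)‖ := by congr 1; ring
    _ ≤ ‖w - z‖ + ‖z - z₀‖ := norm_add_le _ _
    _ ≤ _ := by linarith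

end UnboundedOp

namespace Jacobi

open Filter

variable {a b : ℕ → ℝ}

/-! ### Variation of constants -/

/-- The solution of `𝒥u - z u = h`, `u₀ = 0`, in terms of two solutions of the homogeneous
equation. -/
def volterra (x y h : ℕ → ℂ) (n : ℕ) : ℂ :=
  y n * ∑ k ∈ Finset.range n, x k * h k - x n * ∑ k ∈ Finset.range n, y k * h k

/-- The newest summand enters with the Wronskian of `p` and `q`, equal to 1, as factor, and yields
`h n`. In row zero `q` fails the equation, but its coefficient there is an empty sum. -/
theorem matrixAct_volterra (ha : ∀ n, 0 < a n) (z : ℂ) (h : ℕ → ℂ) :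
    matrixAct a b (volterra (p a b z) (q a b z) h) =
      z • volterra (p a b z) (q a b z) h + h := by
  funext n
  have hW := wronskian_p_q (b := b) ha z n
  simp only [wronskian] at hW
  cases n with
  | zero =>
    simp only [matrixAct_zero, volterra, Pi.add_apply, Pi.smul_apply, smul_eq_mul,
      Finset.sum_range_zero, Finset.sum_range_one, zero_add] at *
    linear_combination h 0 * hW
  | succ n =>
    have hp := congrFun (matrixAct_p (b := b) ha z) (n + 1)
    have hq := matrixAct_q_succ (b := b) ha z n
    simp only [matrixAct_succ, volterra, Pi.add_apply, Pi.smul_apply, smul_eq_mul,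
      Finset.sum_range_succ] at *
    linear_combination h (n + 1) * hW +
      (∑ k ∈ Finset.range n, p a b z k * h k + p a b z n * h n) * hq -
      (∑ k ∈ Finset.range n, q a b z k * h k + q a b z n * h n) * hp

theorem norm_sum_mul_le (x h : L2) (n : ℕ) :
    ‖∑ k ∈ Finset.range n, x k * h k‖ ≤ ‖x‖ * ‖h‖ := by
  have hpq : (2 : ENNReal).toReal.HolderConjugate (2 : ENNReal).toReal := by
    simpa using Real.HolderConjugate.two_two
  calc ‖∑ k ∈ Finset.range n, x k * h k‖ ≤ ∑ k ∈ Finset.range n, ‖x k‖ * ‖h k‖ := by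
        refine (norm_sum_le _ _).trans_eq (Finset.sum_congr rfl fun k _ => norm_mul _ _)
    _ ≤ ∑' k, ‖x k‖ * ‖h k‖ :=
        (lp.summable_mul hpq x h).sum_le_tsum _ fun k _ => by positivity
    _ ≤ _ := lp.tsum_mul_le_mul_norm' hpq x h

/-- The sequence of absolute values. -/
noncomputable def absSeq (x : L2) : lp (fun _ : ℕ => ℝ) 2 :=
  ⟨fun n => ‖x n‖, memℓp_norm_iff.2 (lp.memℓp x)⟩

theorem memℓp_of_norm_le {u : ℕ → ℂ} {f : lp (fun _ : ℕ => ℝ) 2} (h : ∀ n, ‖u n‖ ≤ f n) :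
    Memℓp u 2 :=
  (lp.memℓp f).mono h

theorem norm_volterra_le (x y h : L2) (n : ℕ) :
    ‖volterra x y h n‖ ≤ (‖h‖ • (‖x‖ • absSeq y + ‖y‖ • absSeq x)) n := by
  have h1 := norm_sum_mul_le x h n
  have h2 := norm_sum_mul_le y h n
  have h3 : (‖h‖ • (‖x‖ • absSeq y + ‖y‖ • absSeq x)) n =
      ‖y n‖ * (‖x‖ * ‖h‖) + ‖x n‖ * (‖y‖ * ‖h‖) := by
    change ‖h‖ * (‖x‖ * ‖y n‖ + ‖y‖ * ‖x n‖) = _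
    ring
  rw [h3, volterra]
  refine (norm_sub_le _ _).trans ?_
  rw [norm_mul, norm_mul]
  gcongr

/-- The Volterra operator of two square summable sequences. -/
noncomputable def volterraCLM (x y : L2) : L2 →L[ℂ] L2 :=
  LinearMap.mkContinuous
    { toFun := fun h => ⟨volterra x y h, memℓp_of_norm_le (norm_volterra_le x y h)⟩
      map_add' := fun h k => lp.ext (funext fun n => by
        change volterra x y (h + k : L2) n = volterra x y h n + volterra x y k n
        simp only [volterra, lp.coeFn_add, Pi.add_apply, mul_add, Finset.sum_add_distrib]
        ring)
      map_smul' := fun c h => lp.ext (funext fun n => by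
        change volterra x y (c • h : L2) n = c * volterra x y h n
        simp only [volterra, lp.coeFn_smul, Pi.smul_apply, smul_eq_mul, mul_left_comm _ c,
          ← Finset.mul_sum]
        ring) }
    ‖‖x‖ • absSeq y + ‖y‖ • absSeq x‖ fun h => by
      refine (lp.norm_mono (y := ‖h‖ • (‖x‖ • absSeq y + ‖y‖ • absSeq x))
        (by norm_num) fun n => (norm_volterra_le x y h n).trans (le_abs_self _)).trans_eq ?_
      rw [norm_smul, norm_norm, mul_comm]

theorem volterraCLM_apply (x y h : L2) : (volterraCLM x y h : ℕ → ℂ) = volterra x y h := rfl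

/-- This bounds column `j` of the kernel by quantities square summable in `j`, which gives the
Hilbert–Schmidt property. -/
theorem norm_volterraCLM_unitVec_le (x y : L2) (j : ℕ) :
    ‖volterraCLM x y (unitVec j)‖ ≤ ‖x j‖ * ‖absSeq y‖ + ‖y j‖ * ‖absSeq x‖ := by
  have h1 : ∀ n, ‖volterraCLM x y (unitVec j) n‖ ≤ ‖(‖x j‖ • absSeq y + ‖y j‖ • absSeq x) n‖ := by
    intro n
    have hs : ∀ w : L2, ‖∑ k ∈ Finset.range n, w k * unitVec j k‖ ≤ ‖w j‖ := fun w => by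
      by_cases hj : j ∈ Finset.range n
      · rw [Finset.sum_eq_single_of_mem j hj fun k _ hk => by
          rw [unitVec, lp.single_apply_ne 2 j 1 hk, mul_zero], unitVec, lp.single_apply_self,
          mul_one]
      · rw [Finset.sum_eq_zero fun k hk => by
          rw [unitVec, lp.single_apply_ne 2 j 1 (fun h => hj (h ▸ hk)), mul_zero], norm_zero]
        exact norm_nonneg _
    have h2 : (‖x j‖ • absSeq y + ‖y j‖ • absSeq x) n = ‖y n‖ * ‖x j‖ + ‖x n‖ * ‖y j‖ := by
      change ‖x j‖ * ‖y n‖ + ‖y j‖ * ‖x n‖ = _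
      ring
    rw [h2, Real.norm_of_nonneg (by positivity), volterraCLM_apply, volterra]
    refine (norm_sub_le _ _).trans ?_
    rw [norm_mul, norm_mul]
    gcongr
    exacts [hs x, hs y]
  refine (lp.norm_mono (by norm_num) h1).trans ((norm_add_le _ _).trans_eq ?_)
  simp only [norm_smul, norm_norm]

/-- The standard Hilbert basis of `ℓ²`. -/
noncomputable def unitBasis : HilbertBasis ℕ ℂ L2 := .ofRepr (LinearIsometryEquiv.refl ℂ L2)

theorem unitBasis_apply (j : ℕ) : unitBasis j = unitVec j := by
  rw [← unitBasis.repr_symm_single j]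
  rfl

theorem isHilbertSchmidt_volterraCLM_sub (x y v : L2) (φ : StrongDual ℂ L2) :
    UnboundedOp.IsHilbertSchmidt (volterraCLM x y - φ.smulRight v) := by
  refine ⟨ℕ, unitBasis, ?_⟩
  set w : L2 := (InnerProductSpace.toDual ℂ L2).symm φ with hw
  have hφ : ∀ j, ‖φ (unitVec j)‖ = ‖w j‖ := fun j => by
    rw [← InnerProductSpace.toDual_symm_apply, ← hw, unitVec, lp.inner_single_right]
    simp
  have hsum : ∀ u : L2, Summable fun j => ‖u j‖ ^ 2 := fun u => memℓp_two_iff.1 (lp.memℓp u)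
  refine Summable.of_nonneg_of_le (fun j => by positivity) (fun j => ?_)
    ((((hsum x).mul_left (3 * ‖absSeq y‖ ^ 2)).add ((hsum y).mul_left (3 * ‖absSeq x‖ ^ 2))).add
      ((hsum w).mul_left (3 * ‖v‖ ^ 2)))
  have h1 : ‖(volterraCLM x y - φ.smulRight v) (unitBasis j)‖ ≤
      ‖x j‖ * ‖absSeq y‖ + ‖y j‖ * ‖absSeq x‖ + ‖w j‖ * ‖v‖ := by
    rw [unitBasis_apply, _root_.sub_apply, ContinuousLinearMap.smulRight_apply]
    refine (norm_sub_le _ _).trans (add_le_add (norm_volterraCLM_unitVec_le x y j) ?_)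
    rw [norm_smul, hφ]
  refine (pow_le_pow_left₀ (norm_nonneg _) h1 2).trans ?_
  nlinarith [sq_nonneg (‖x j‖ * ‖absSeq y‖ - ‖y j‖ * ‖absSeq x‖),
    sq_nonneg (‖x j‖ * ‖absSeq y‖ - ‖w j‖ * ‖v‖), sq_nonneg (‖y j‖ * ‖absSeq x‖ - ‖w j‖ * ‖v‖)]

/-! ### The resolvent -/

theorem IsMaximal.of_matrixAct_eq {u h : ℕ → ℂ} {z : ℂ} (hu : Memℓp u 2) (hh : Memℓp h 2)
    (huh : matrixAct a b u = z • u + h) : IsMaximal a b u :=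
  ⟨hu, by rw [huh]; exact (hu.const_smul z).add hh⟩

/-- Substituting `𝒥Vh = z Vh + h` turns the form into `∑ (g · h + (z g - 𝒥g) · Vh)`, where no
unbounded operator acts on `h`. -/
theorem exists_dual_eq_boundaryForm {g : ℕ → ℂ} (hg : IsMaximal a b g) {z : ℂ}
    (V : L2 →L[ℂ] L2) (hV : ∀ h : L2, matrixAct a b (V h) = z • (V h : ℕ → ℂ) + h) :
    ∃ φ : StrongDual ℂ L2, ∀ h, φ h = boundaryForm a b g (V h) := by
  set x : L2 := star ⟨g, hg.1⟩ with hx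
  set y : L2 := star (z • ⟨g, hg.1⟩ - ⟨matrixAct a b g, hg.2⟩) with hy
  refine ⟨innerSL ℂ x + (innerSL ℂ y).comp V, fun h => ?_⟩
  have h1 := (lp.hasSum_inner (𝕜 := ℂ) x h).add (lp.hasSum_inner (𝕜 := ℂ) y (V h))
  refine h1.tsum_eq.symm.trans (tsum_congr fun k => ?_)
  have h2 : x k = star (g k) := rfl
  have h3 : y k = star (z * g k - matrixAct a b g k) := rfl
  have h4 := congrFun (hV h) k
  simp only [Pi.add_apply, Pi.smul_apply, smul_eq_mul] at h4
  rw [greenTerm, h4, h2, h3]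
  simp only [RCLike.inner_apply, RCLike.star_def, RCLike.conj_conj]
  ring

theorem IsBoundaryRestriction.apply_eq {J : L2 →ₗ.[ℂ] L2} {g : ℕ → ℂ}
    (hJ : IsBoundaryRestriction a b J g) {u h : L2} {z : ℂ} (hu : u ∈ J.domain) :
    J ⟨u, hu⟩ - z • u = h ↔ matrixAct a b u = z • (u : ℕ → ℂ) + h := by
  rw [← apply_eq_of_le_Jmax hJ.le_Jmax ⟨u, hu⟩, sub_eq_iff_eq_add']
  exact ⟨fun hh => congrArg (fun x : L2 => (x : ℕ → ℂ)) hh, fun hh => lp.ext hh⟩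

theorem IsBoundaryRestriction.exists_resolvent {J : L2 →ₗ.[ℂ] L2} {g : ℕ → ℂ}
    (hJ : IsBoundaryRestriction a b J g) (ha : ∀ n, 0 < a n)
    (hLC : (Jmin a b).closure ≠ Jmax a b) {z : ℂ} (hz : ¬ UnboundedOp.IsEigenvalue J z) :
    ∃ R : L2 →L[ℂ] L2,
      UnboundedOp.IsResolventAt J z R ∧ UnboundedOp.IsHilbertSchmidt R := by
  have hp := isMaximal_p ha hLC z
  have hq := isMaximal_q ha hLC z
  set P : L2 := ⟨p a b z, hp.1⟩ with hP
  set V : L2 →L[ℂ] L2 := volterraCLM P ⟨q a b z, hq.1⟩ with hVdef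
  have hV : ∀ h : L2, matrixAct a b (V h) = z • (V h : ℕ → ℂ) + h :=
    fun h => matrixAct_volterra ha z h
  obtain ⟨φ, hφ⟩ := exists_dual_eq_boundaryForm hJ.isMaximal V hV
  set c : ℂ := boundaryForm a b g (p a b z) with hc
  -- Otherwise `p(z)` satisfies the boundary condition and is an eigenvector.
  have hc0 : c ≠ 0 := by
    intro h0
    have hmem : P ∈ J.domain := (hJ.mem_domain_iff P).2 ⟨hp, h0⟩
    refine hz ⟨⟨P, hmem⟩, fun h => ?_, ?_⟩
    · have h1 : P = 0 := congrArg Subtype.val h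
      have h2 : P 0 = 0 := by rw [h1]; rfl
      exact one_ne_zero h2
    · have h1 := (hJ.apply_eq (z := z) (h := 0) hmem).2 (by
        rw [lp.coeFn_zero, add_zero]
        exact matrixAct_p ha z)
      exact sub_eq_zero.1 h1
  refine ⟨V - (c⁻¹ • φ).smulRight P, ?_, isHilbertSchmidt_volterraCLM_sub _ _ _ _⟩
  set R : L2 →L[ℂ] L2 := V - (c⁻¹ • φ).smulRight P with hR
  have hRcoe : ∀ h : L2, (R h : ℕ → ℂ) = V h - (c⁻¹ * φ h) • p a b z := fun h => rfl
  have hRact : ∀ h : L2, matrixAct a b (R h) = z • (R h : ℕ → ℂ) + h := fun h => by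
    rw [hRcoe, map_sub, map_smul, matrixAct_p ha, hV, smul_sub, smul_comm z]
    abel
  have hRmem : ∀ h : L2, R h ∈ J.domain := fun h => by
    refine (hJ.mem_domain_iff _).2
      ⟨IsMaximal.of_matrixAct_eq (lp.memℓp _) (lp.memℓp h) (hRact h), ?_⟩
    have hVm := IsMaximal.of_matrixAct_eq (lp.memℓp _) (lp.memℓp h) (hV h)
    rw [hRcoe, boundaryForm_sub_right hJ.isMaximal hVm (hp.smul _), boundaryForm_smul_right,
      ← hc, hφ]
    field_simp
    ring
  have hRres : ∀ h : L2, J ⟨R h, hRmem h⟩ - z • R h = h := fun h =>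
    (hJ.apply_eq (hRmem h)).2 (hRact h)
  intro u h
  constructor
  · rintro rfl
    exact ⟨hRmem h, hRres h⟩
  · rintro ⟨hu, hJu⟩
    by_contra hne
    -- Two distinct solutions of `(J - z)u = h` would differ by an eigenvector.
    refine hz ⟨⟨R h, hRmem h⟩ - ⟨u, hu⟩, fun h0 => hne ?_, ?_⟩
    · exact congrArg Subtype.val (sub_eq_zero.1 h0)
    · have h1 := (hRres h).trans hJu.symm
      rw [LinearPMap.map_sub]
      change _ = z • (R h - u)
      rw [smul_sub, sub_eq_sub_iff_add_eq_add, ← sub_eq_sub_iff_add_eq_add.1 h1.symm]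
      abel

/-- Evaluation at index zero is injective on the eigenspace, since an eigenvector is `u 0` times
`p(z)`. -/
theorem IsBoundaryRestriction.finiteDimensional_eigenspace {J : L2 →ₗ.[ℂ] L2} {g : ℕ → ℂ}
    (hJ : IsBoundaryRestriction a b J g) (ha : ∀ n, 0 < a n) (z : ℂ) :
    FiniteDimensional ℂ (UnboundedOp.eigenspace J z) := by
  let f : UnboundedOp.eigenspace J z →ₗ[ℂ] ℂ :=
    { toFun := fun u => ((u : J.domain) : L2) 0
      map_add' := fun _ _ => rfl
      map_smul' := fun _ _ => rfl }
  have hf : ∀ u : UnboundedOp.eigenspace J z,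
      (((u : J.domain) : L2) : ℕ → ℂ) = f u • p a b z := fun u => by
    refine eq_smul_p ha ?_
    have h1 : J u - z • ((u : J.domain) : L2) = 0 := u.2
    have h2 := (hJ.apply_eq (u : J.domain).2).1 h1
    rwa [lp.coeFn_zero, add_zero] at h2
  refine Module.Finite.of_injective f fun u v huv => ?_
  refine Subtype.ext (Subtype.ext (lp.ext ?_))
  rw [hf u, hf v, huv]

theorem IsBoundaryRestriction.hasDiscreteSpectrum {J : L2 →ₗ.[ℂ] L2} {g : ℕ → ℂ}
    (hJ : IsBoundaryRestriction a b J g) (ha : ∀ n, 0 < a n)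
    (hLC : (Jmin a b).closure ≠ Jmax a b) : UnboundedOp.HasDiscreteSpectrum J := by
  have hspec : ∀ z ∈ UnboundedOp.spectrum J, UnboundedOp.IsEigenvalue J z := fun z hz => by
    by_contra hne
    obtain ⟨R, hR, -⟩ := hJ.exists_resolvent ha hLC hne
    exact hz ⟨R, hR⟩
  have hI : ¬ UnboundedOp.IsEigenvalue J Complex.I := fun h => by
    have h1 := congrArg Complex.im (UnboundedOp.conj_eq_of_isEigenvalue hJ.isFormalAdjoint h)
    norm_num at h1
  obtain ⟨R, hR, hHS⟩ := hJ.exists_resolvent ha hLC hI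
  exact ⟨UnboundedOp.not_accPt_spectrum hJ.isFormalAdjoint hR hHS hspec,
    fun z hz => ⟨hspec z hz, hJ.finiteDimensional_eigenspace ha z⟩⟩

end Jacobi

theorem corollary2p7 (a b : ℕ → ℝ) (ha : ∀ n, 0 < a n)
    (hLC : (Jacobi.Jmin a b).closure ≠ Jacobi.Jmax a b) :
    (∀ t : OnePoint ℝ,
      (∀ z : ℂ, ¬ UnboundedOp.IsEigenvalue (Jacobi.Jt a b t) z →
        ∃ R : Jacobi.L2 →L[ℂ] Jacobi.L2,
          UnboundedOp.IsResolventAt (Jacobi.Jt a b t) z R ∧ UnboundedOp.IsHilbertSchmidt R) ∧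
      UnboundedOp.HasDiscreteSpectrum (Jacobi.Jt a b t)) ∧
    (∀ J : Jacobi.L2 →ₗ.[ℂ] Jacobi.L2, Jacobi.Jmin a b ≤ J → IsSelfAdjoint J →
      (∀ z : ℂ, ¬ UnboundedOp.IsEigenvalue J z →
        ∃ R : Jacobi.L2 →L[ℂ] Jacobi.L2,
          UnboundedOp.IsResolventAt J z R ∧ UnboundedOp.IsHilbertSchmidt R) ∧
      UnboundedOp.HasDiscreteSpectrum J) := by
  refine ⟨fun t => ?_, fun J hJmin hJ => ?_⟩
  · have h := Jacobi.isBoundaryRestriction_Jt ha hLC t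
    exact ⟨fun z hz => h.exists_resolvent ha hLC hz, h.hasDiscreteSpectrum ha hLC⟩
  · obtain ⟨g, h⟩ := Jacobi.exists_isBoundaryRestriction_of_isSelfAdjoint hLC hJmin hJ
    exact ⟨fun z hz => h.exists_resolvent ha hLC hz, h.hasDiscreteSpectrum ha hLC⟩
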